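/- Let $\Lambda\subset\mathbb{C}$ be a lattice, i.e. $\Lambda=\mathbb{Z}\omega_1+\mathbb{Z}\omega_2$ with $\omega_1,\omega_2\in\mathbb{C}$ linearly independent over $\mathbb{R}$, and let $\wp$ be the Weierstrass function of $\Lambda$. (1) Let $\gamma\in\mathbb{C}$ with $3\gamma\in\Lambda$. Then the function $f(x)=\wp(x+\gamma)$, defined for $x+\gamma\notin\Lambda$, is holomorphic on its domain and satisfies $$\begin{vmatrix}1&1&1\\ f(x)&f(y)&f(z)\\ f'(x)&f'(y)&f'(z)\end{vmatrix}=0$$ for all $x,y,z$ in its domain with $x+y+z=0$. (2) Let $\gamma_1,\gamma_2,\gamma_3\in\mathbb{C}$ with $\gamma_1+\gamma_2+\gamma_3\in\Lambda$. Then the functions $f(x)=\wp(x+\gamma_1)$, $g(y)=\wp(y+\gamma_2)$, $h(z)=\wp(z+\gamma_3)$, defined for $x+\gamma_1\notin\Lambda$, $y+\gamma_2\notin\Lambda$, $z+\gamma_3\notin\Lambda$ respectively, are holomorphic on their domains and satisfy $$\begin{vmatrix}1&1&1\\ f(x)&g(y)&h(z)\\ f'(x)&g'(y)&h'(z)\end{vmatrix}=0$$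 for all $x,y,z$ in the respective domains with $x+y+z=0$. Moreover the shifts may be chosen with sum zero without changing the functions: there is $\gamma_3'\in\mathbb{C}$ with $\gamma_1+\gamma_2+\gamma_3'=0$ such that $z\mapsto\wp(z+\gamma_3')$ and $z\mapsto\wp(z+\gamma_3)$ have the same domain and are equal. -/

import Mathlib

/-- The `3 × 3` determinant with rows `(1, 1, 1)`, `(f x, g y, h z)` and `(f' x, g' y, h' z)`. -/
noncomputable def funDet (f g h : ℂ → ℂ) (x y z : ℂ) : ℂ :=
  Matrix.det !![1, 1, 1; f x, g y, h z; deriv f x, deriv g y, deriv h z]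

/-- The functions `f`, `g`, `h`, with respective domains `A`, `B`, `C`, are (complex)
differentiable at every point of their domains, and their determinant `funDet` vanishes at all
points `x`, `y`, `z` of the respective domains with `x + y + z = 0`. -/
def SatisfiesMixedDetEq (A B C : Set ℂ) (f g h : ℂ → ℂ) : Prop :=
  (∀ x ∈ A, DifferentiableAt ℂ f x) ∧ (∀ y ∈ B, DifferentiableAt ℂ g y) ∧
    (∀ z ∈ C, DifferentiableAt ℂ h z) ∧
    ∀ x ∈ A, ∀ y ∈ B, ∀ z ∈ C, x + y + z = 0 → funDet f g h x y z = 0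

/-- The equation for one function `f` with domain `A`: the case `f = g = h`. -/
def SatisfiesDetEq (A : Set ℂ) (f : ℂ → ℂ) : Prop :=
  SatisfiesMixedDetEq A A A f f f

/-- The set of points at which `x ↦ ℘(x + γ)` is defined, that is, which are not poles of it. -/
def wpDomain (L : PeriodPair) (γ : ℂ) : Set ℂ :=
  {x | x + γ ∉ L.lattice}

/-- The translate `x ↦ ℘(x + γ)` of the Weierstrass function `℘` of the period lattice of `L`. -/
noncomputable def wpShift (L : PeriodPair) (γ : ℂ) : ℂ → ℂ :=
  fun x => L.weierstrassP (x + γ)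

/-! Fix `v` off the lattice and view the determinant at `u`, `v`, `-(u + v)` as a function of `u`
(`addDet`, up to sign). It is elliptic, and its only possible poles lie in Λ and -v + Λ. At 0 the
polar parts of ℘ and ℘' cancel against the Taylor expansion of ℘ at `v` (`addDet_removable_zero`);
the reflection u ↦ -v - u and periodicity carry this to all other poles. By Liouville the function
is constant, and being odd under the reflection it vanishes at the fixed point -v/2, hence wherever
it is regular. The shifts γᵢ enter only through the sum of the three arguments being a period. -/

open Filter Topology in
/-- An elliptic function all of whose singularities are removable is constant. -/
lemma PeriodPair.apply_eq_apply_of_removable (L : PeriodPair) {F : ℂ → ℂ}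
    (hrem : ∀ x, ∃ g, AnalyticAt ℂ g x ∧ F =ᶠ[𝓝[≠] x] g)
    (hper : ∀ l ∈ L.lattice, ∀ x, F (x + l) = F x)
    {x y : ℂ} (hx : ContinuousAt F x) (hy : ContinuousAt F y) : F x = F y := by
  -- Punctured limits fill in the removable singularities: `G` is entire and periodic, hence
  -- bounded, and agrees with `F` wherever `F` is continuous.
  set G : ℂ → ℂ := fun x ↦ limUnder (𝓝[≠] x) F with hG
  have hGF : ∀ x, ContinuousAt F x → G x = F x := fun x hx ↦
    (hx.tendsto.mono_left nhdsWithin_le_nhds).limUnder_eq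
  have hGdiff : Differentiable ℂ G := by
    intro x
    obtain ⟨g, hg, hFg⟩ := hrem x
    have hGg : G =ᶠ[𝓝 x] g := by
      have hev : ∀ᶠ y in 𝓝 x, y ≠ x → F y = g y := eventually_nhdsWithin_iff.mp hFg
      filter_upwards [hev.eventually_nhds, hg.eventually_analyticAt] with y hy hgy
      refine ((hgy.continuousAt.tendsto.mono_left nhdsWithin_le_nhds).congr' ?_).limUnder_eq
      rcases eq_or_ne y x with rfl | hyx
      · exact hFg.symm
      · refine Eventually.filter_mono nhdsWithin_le_nhds ?_
        filter_upwards [hy, eventually_ne_nhds hyx] with z hz hzx using (hz hzx).symm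
    exact hGg.differentiableAt_iff.mpr hg.differentiableAt
  have hGper : ∀ z, ∀ w ∈ L.lattice, G (z + w) = G z := by
    intro z w hw
    obtain ⟨g, hg, hFg⟩ := hrem z
    have hmap : Tendsto (fun y ↦ y - w) (𝓝[≠] (z + w)) (𝓝[≠] z) := by
      refine tendsto_nhdsWithin_iff.mpr ⟨?_, ?_⟩
      · have : Tendsto (fun y ↦ y - w) (𝓝 (z + w)) (𝓝 (z + w - w)) :=
          (continuous_id.sub continuous_const).tendsto _
        rw [add_sub_cancel_right] at this
        exact this.mono_left nhdsWithin_le_nhds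
      · filter_upwards [self_mem_nhdsWithin] with y hy h
        exact hy (by simpa [sub_eq_iff_eq_add] using h)
    have hlim : Tendsto F (𝓝[≠] z) (𝓝 (g z)) :=
      (hg.continuousAt.tendsto.mono_left nhdsWithin_le_nhds).congr' hFg.symm
    have hlim' : Tendsto F (𝓝[≠] (z + w)) (𝓝 (g z)) := by
      refine (hlim.comp hmap).congr fun y ↦ ?_
      rw [Function.comp_apply, ← hper w hw, sub_add_cancel]
    rw [hG]
    exact hlim'.limUnder_eq.trans hlim.limUnder_eq.symm
  rw [← hGF x hx, ← hGF y hy]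
  exact hGdiff.apply_eq_apply_of_bounded (IsZLattice.isCompact_range_of_periodic L.lattice _
    hGdiff.continuous fun z w hw ↦ hGper z w hw).isBounded x y

/-- A function analytic at `0` has a second order Taylor expansion with analytic remainder. -/
lemma AnalyticAt.exists_eq_quadratic_add {P : ℂ → ℂ} (hP : AnalyticAt ℂ P 0) :
    ∃ (a b c : ℂ) (r : ℂ → ℂ), AnalyticAt ℂ r 0 ∧
      ∀ u, P u = a + b * u + c * u ^ 2 + u ^ 3 * r u := by
  have key : ∀ f : ℂ → ℂ, AnalyticAt ℂ f 0 →
      AnalyticAt ℂ (dslope f 0) 0 ∧ ∀ u, f u = f 0 + u * dslope f 0 u := by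
    rintro f ⟨p, hp⟩
    refine ⟨⟨_, hp.has_fpower_series_dslope_fslope⟩, fun u ↦ ?_⟩
    have := sub_smul_dslope f 0 u
    simp only [sub_zero, smul_eq_mul] at this
    rw [this]; ring
  obtain ⟨h₁, e₁⟩ := key P hP
  obtain ⟨h₂, e₂⟩ := key _ h₁
  obtain ⟨h₃, e₃⟩ := key _ h₂
  refine ⟨P 0, dslope P 0 0, dslope (dslope P 0) 0 0, _, h₃, fun u ↦ ?_⟩
  rw [e₁ u, e₂ u, e₃ u]
  ring

open Filter Topology in
/-- The combination `u (P'(u) + P'(0)) - 2 (P(u) - P(0))` vanishes to third order at `0`. -/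
lemma AnalyticAt.exists_trapezoid_eq_cube_mul {P : ℂ → ℂ} (hP : AnalyticAt ℂ P 0) :
    ∃ s : ℂ → ℂ, AnalyticAt ℂ s 0 ∧
      ∀ᶠ u in 𝓝 0, u * (deriv P u + deriv P 0) - 2 * (P u - P 0) = u ^ 3 * s u := by
  obtain ⟨a, b, c, r, hr, h⟩ := hP.exists_eq_quadratic_add
  have hderiv : ∀ u, AnalyticAt ℂ r u →
      deriv P u = b + 2 * c * u + 3 * u ^ 2 * r u + u ^ 3 * deriv r u := by
    intro u hu
    have h₁ := ((((hasDerivAt_id u).const_mul b).const_add a).add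
      (((hasDerivAt_id u).pow 2).const_mul c)).add
        (((hasDerivAt_id u).pow 3).mul hu.differentiableAt.hasDerivAt)
    have h₂ : HasDerivAt P _ u :=
      h₁.congr_of_eventuallyEq (Eventually.of_forall fun z ↦ by simp [h z])
    rw [h₂.deriv]
    simp
    ring
  -- The trapezoid rule is exact on quadratics, so only the remainder contributes: u(3u²r + u³r') -
  -- 2u³r = u³(r + ur').
  refine ⟨fun u ↦ r u + u * deriv r u, hr.add (analyticAt_id.mul hr.deriv), ?_⟩
  filter_upwards [hr.eventually_analyticAt] with u hu
  rw [hderiv u hu, hderiv 0 hr, h u, h 0]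
  ring

namespace PeriodPair

/-- The determinant with rows `(1, 1, 1)`, `(℘ u, ℘ v, ℘ w)`, `(℘' u, ℘' v, ℘' w)`
for `w = -(u + v)`, up to sign. -/
noncomputable def addDet (L : PeriodPair) (v u : ℂ) : ℂ :=
  (L.derivWeierstrassP u - L.derivWeierstrassP v) * (L.weierstrassP (u + v) - L.weierstrassP v) +
    (L.weierstrassP u - L.weierstrassP v) *
      (L.derivWeierstrassP (u + v) + L.derivWeierstrassP v)

/-- The reflection swaps the arguments u and w = -(u + v), that is, two columns of the determinant.
-/
lemma addDet_neg_sub (L : PeriodPair) (v u : ℂ) : L.addDet v (-v - u) = -L.addDet v u := by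
  have h₁ : -v - u = -(u + v) := by ring
  have h₂ : -v - u + v = -u := by ring
  rw [addDet, addDet, h₂, h₁]
  simp only [weierstrassP_neg, derivWeierstrassP_neg]
  ring

lemma addDet_add (L : PeriodPair) (v u : ℂ) {l : ℂ} (hl : l ∈ L.lattice) :
    L.addDet v (u + l) = L.addDet v u := by
  lift l to L.lattice using hl
  rw [addDet, addDet, add_right_comm]
  simp only [weierstrassP_add_coe, derivWeierstrassP_add_coe]

lemma analyticAt_addDet (L : PeriodPair) {u v : ℂ} (hu : u ∉ L.lattice) (huv : u + v ∉ L.lattice) :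
    AnalyticAt ℂ (L.addDet v) u := by
  have h₁ := L.analyticOnNhd_weierstrassP u hu
  have h₂ := L.analyticOnNhd_derivWeierstrassP u hu
  have h₃ : AnalyticAt ℂ (fun z ↦ L.weierstrassP (z + v)) u :=
    (L.analyticOnNhd_weierstrassP (u + v) huv).fun_comp (f := fun z ↦ z + v) (by fun_prop)
  have h₄ : AnalyticAt ℂ (fun z ↦ L.derivWeierstrassP (z + v)) u :=
    (L.analyticOnNhd_derivWeierstrassP (u + v) huv).fun_comp (f := fun z ↦ z + v) (by fun_prop)
  exact ((h₂.sub analyticAt_const).mul (h₃.sub analyticAt_const)).add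
    ((h₁.sub analyticAt_const).mul (h₄.add analyticAt_const))

open Filter Topology

/-- With ℘ = u⁻² + … and ℘' = -2u⁻³ + …, the singular terms add up to the trapezoid expression of
P(u) = ℘(u + v) divided by u³, which is analytic. -/
lemma addDet_removable_zero (L : PeriodPair) {v : ℂ} (hv : v ∉ L.lattice) :
    ∃ g, AnalyticAt ℂ g 0 ∧ L.addDet v =ᶠ[𝓝[≠] 0] g := by
  set P : ℂ → ℂ := fun u ↦ L.weierstrassP (u + v) with hPdef
  have hP : AnalyticAt ℂ P 0 :=
    (L.analyticOnNhd_weierstrassP (0 + v) (by simpa using hv)).fun_comp (f := fun z ↦ z + v)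
      (by fun_prop)
  have hP' : ∀ u, deriv P u = L.derivWeierstrassP (u + v) := fun u ↦ by
    rw [hPdef, deriv_comp_add_const, deriv_weierstrassP]
  obtain ⟨s, hs, hN⟩ := hP.exists_trapezoid_eq_cube_mul
  have hE := L.analyticAt_weierstrassPExcept 0
  have hE' := L.analyticAt_derivWeierstrassPExcept 0
  refine ⟨fun u ↦ (L.derivWeierstrassPExcept 0 u - L.derivWeierstrassP v) * (P u - P 0) +
    (L.weierstrassPExcept 0 u - L.weierstrassP v) * (deriv P u + deriv P 0) + s u, ?_, ?_⟩
  · have := hP.deriv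
    fun_prop
  · filter_upwards [self_mem_nhdsWithin, hN.filter_mono nhdsWithin_le_nhds] with u hu hNu
    have hu : u ≠ 0 := hu
    have e₁ := L.weierstrassPExcept_add 0 u
    have e₂ := L.derivWeierstrassPExcept_sub 0 u
    simp only [ZeroMemClass.coe_zero, sub_zero] at e₁ e₂
    have hs' : s u = (u * (deriv P u + deriv P 0) - 2 * (P u - P 0)) / u ^ 3 := by
      rw [hNu]; field_simp
    rw [hs', addDet, ← e₁, ← e₂, hP', hP', hPdef]
    simp only [zero_add]
    field_simp
    ring

lemma addDet_removable (L : PeriodPair) {v : ℂ} (hv : v ∉ L.lattice) (x : ℂ) :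
    ∃ g, AnalyticAt ℂ g x ∧ L.addDet v =ᶠ[𝓝[≠] x] g := by
  have hlat : ∀ l ∈ L.lattice, ∃ g, AnalyticAt ℂ g l ∧ L.addDet v =ᶠ[𝓝[≠] l] g := by
    intro l hl
    obtain ⟨g, hg, h⟩ := L.addDet_removable_zero hv
    refine ⟨fun u ↦ g (u - l), ?_, ?_⟩
    · exact AnalyticAt.fun_comp (g := g) (f := fun u ↦ u - l) (by simpa using hg) (by fun_prop)
    · rw [EventuallyEq, eventually_nhdsWithin_iff] at h ⊢
      have ht : Tendsto (fun u : ℂ ↦ u - l) (𝓝 l) (𝓝 0) := by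
        have : Continuous fun u : ℂ ↦ u - l := by fun_prop
        simpa using this.tendsto l
      filter_upwards [ht.eventually h] with u hu hul
      rw [← hu (by simpa [sub_eq_zero] using hul), ← L.addDet_add v (u - l) hl, sub_add_cancel]
  by_cases hx : x ∈ L.lattice
  · exact hlat x hx
  by_cases hxv : x + v ∈ L.lattice
  -- The reflection sends a pole in -v + Λ to a lattice point, already treated.
  · obtain ⟨g, hg, h⟩ := hlat (-v - x) (by
      have := neg_mem hxv
      rwa [neg_add_rev, ← sub_eq_add_neg] at this)
    refine ⟨fun u ↦ -g (-v - u), ?_, ?_⟩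
    · exact (AnalyticAt.fun_comp (g := g) (f := fun u ↦ -v - u) hg (by fun_prop)).neg
    · rw [EventuallyEq, eventually_nhdsWithin_iff] at h ⊢
      have ht : Tendsto (fun u : ℂ ↦ -v - u) (𝓝 x) (𝓝 (-v - x)) :=
        (continuous_const.sub continuous_id : Continuous fun u : ℂ ↦ -v - u).tendsto x
      filter_upwards [ht.eventually h] with u hu hux
      rw [← hu (by simpa using hux), addDet_neg_sub, neg_neg]
  · exact ⟨_, L.analyticAt_addDet hx hxv, EventuallyEq.rfl⟩

/-- The addition theorem for `℘`. -/
lemma addDet_eq_zero (L : PeriodPair) {u v : ℂ} (hu : u ∉ L.lattice) (hv : v ∉ L.lattice)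
    (huv : u + v ∉ L.lattice) : L.addDet v u = 0 := by
  have h₁ : -v / 2 ∉ L.lattice := fun h ↦ hv (by
    have := neg_mem (add_mem h h)
    rwa [add_halves, neg_neg] at this)
  have h₂ : -v / 2 + v ∉ L.lattice := fun h ↦ h₁ (by
    have := neg_mem h
    rwa [show -(-v / 2 + v) = -v / 2 by ring] at this)
  -- Compare with the value at -v/2, a regular point fixed by the reflection, where the value equals
  -- its own negative.
  rw [L.apply_eq_apply_of_removable (L.addDet_removable hv) (fun l hl x ↦ L.addDet_add v x hl)
    (L.analyticAt_addDet hu huv).continuousAt (L.analyticAt_addDet h₁ h₂).continuousAt]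
  have := L.addDet_neg_sub v (-v / 2)
  rwa [show -v - -v / 2 = -v / 2 by ring, self_eq_neg] at this

/-- The points `(℘ u, ℘' u)`, `(℘ v, ℘' v)`, `(℘ w, ℘' w)` are collinear if `u + v + w` is a
period. -/
lemma det_weierstrassP_eq_zero (L : PeriodPair) {u v w : ℂ} (hu : u ∉ L.lattice)
    (hv : v ∉ L.lattice) (hw : w ∉ L.lattice) (h : u + v + w ∈ L.lattice) :
    Matrix.det !![1, 1, 1; L.weierstrassP u, L.weierstrassP v, L.weierstrassP w;
      L.derivWeierstrassP u, L.derivWeierstrassP v, L.derivWeierstrassP w] = 0 := by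
  have huv : u + v ∉ L.lattice := fun h' ↦ hw (by simpa using sub_mem h h')
  have hw' : w = -(u + v) + ((⟨_, h⟩ : L.lattice) : ℂ) := by
    simp only
    ring
  have e₁ : L.weierstrassP w = L.weierstrassP (u + v) := by
    rw [hw', weierstrassP_add_coe, weierstrassP_neg]
  have e₂ : L.derivWeierstrassP w = -L.derivWeierstrassP (u + v) := by
    rw [hw', derivWeierstrassP_add_coe, derivWeierstrassP_neg]
  have key := L.addDet_eq_zero hu hv huv
  rw [addDet] at key
  rw [Matrix.det_fin_three, e₁, e₂]
  simp
  linear_combination key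

end PeriodPair

lemma deriv_wpShift (L : PeriodPair) (γ x : ℂ) :
    deriv (wpShift L γ) x = L.derivWeierstrassP (x + γ) := by
  unfold wpShift
  rw [deriv_comp_add_const, L.deriv_weierstrassP]

lemma differentiableAt_wpShift (L : PeriodPair) (γ : ℂ) {x : ℂ} (hx : x ∈ wpDomain L γ) :
    DifferentiableAt ℂ (wpShift L γ) x :=
  DifferentiableAt.comp x (f := fun z ↦ z + γ)
    (L.analyticOnNhd_weierstrassP (x + γ) hx).differentiableAt (by fun_prop)

lemma satisfiesMixedDetEq_wpShift (L : PeriodPair) {γ₁ γ₂ γ₃ : ℂ}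
    (h : γ₁ + γ₂ + γ₃ ∈ L.lattice) :
    SatisfiesMixedDetEq (wpDomain L γ₁) (wpDomain L γ₂) (wpDomain L γ₃)
      (wpShift L γ₁) (wpShift L γ₂) (wpShift L γ₃) := by
  refine ⟨fun x hx ↦ differentiableAt_wpShift L γ₁ hx, fun x hx ↦ differentiableAt_wpShift L γ₂ hx,
    fun x hx ↦ differentiableAt_wpShift L γ₃ hx, fun x hx y hy z hz hxyz ↦ ?_⟩
  rw [funDet, deriv_wpShift, deriv_wpShift, deriv_wpShift]
  refine L.det_weierstrassP_eq_zero hx hy hz ?_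
  rwa [show x + γ₁ + (y + γ₂) + (z + γ₃) = γ₁ + γ₂ + γ₃ by linear_combination hxyz]

theorem lemma2 (L : PeriodPair) :
    (∀ γ : ℂ, 3 * γ ∈ L.lattice → SatisfiesDetEq (wpDomain L γ) (wpShift L γ)) ∧
    (∀ γ₁ γ₂ γ₃ : ℂ, γ₁ + γ₂ + γ₃ ∈ L.lattice →
      SatisfiesMixedDetEq (wpDomain L γ₁) (wpDomain L γ₂) (wpDomain L γ₃)
        (wpShift L γ₁) (wpShift L γ₂) (wpShift L γ₃) ∧
      ∃ γ₃' : ℂ, γ₁ + γ₂ + γ₃' = 0 ∧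
        wpDomain L γ₃' = wpDomain L γ₃ ∧ wpShift L γ₃' = wpShift L γ₃) := by
  -- The new shift -(γ₁ + γ₂) differs from γ₃ by the period γ₁ + γ₂ + γ₃.
  refine ⟨fun γ hγ ↦ satisfiesMixedDetEq_wpShift L ?_, fun γ₁ γ₂ γ₃ h ↦
    ⟨satisfiesMixedDetEq_wpShift L h, -(γ₁ + γ₂), add_neg_cancel _, ?_, ?_⟩⟩
  · rwa [show γ + γ + γ = 3 * γ by ring]
  · ext z
    have e : z + γ₃ = z + -(γ₁ + γ₂) + (γ₁ + γ₂ + γ₃) := by ring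
    rw [wpDomain, wpDomain, Set.mem_ofPred_eq, Set.mem_ofPred_eq, e,
      Submodule.add_mem_iff_left _ h]
  · ext z
    have e : z + γ₃ = z + -(γ₁ + γ₂) + ((⟨_, h⟩ : L.lattice) : ℂ) := by
      simp only
      ring
    rw [wpShift, wpShift, e, L.weierstrassP_add_coe]
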